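/- A hypergraph is a triple $G=(V(G),E(G),f_G)$ with finite sets $V(G)$ of vertices and $E(G)$ of edges and an incidence function $f_G\colon E(G)\to 2^{V(G)}\setminus\{\emptyset\}$; it is simple if $f_G$ is injective. It is called connected, respectively Berge-acyclic, if its incidence graph (the bipartite graph on $V(G)\,\dot\cup\,E(G)$ in which $v\in V(G)$ and $e\in E(G)$ are adjacent if and only if $v\in f_G(e)$) is connected, respectively acyclic. An incidence homomorphism from a hypergraph $F$ to a hypergraph $G$ is a pair of maps $h_V\colon V(F)\to V(G)$ and $h_E\colon E(F)\to E(G)$ with $h_V(f_F(e))\subseteq f_G(h_E(e))$ for every $e\in E(F)$; let $\mathsf{InHom}(F,G)$ be the number of incidence homomorphisms from $F$ to $G$. Using $\{\!\{\cdot\}\!\}$ for multisets, colour refinement on $G$ is defined by $c^G_0(v):=1$ and \[ c^G_{i+1}(v):=\{\!\{\,\{\!\{\,c^G_i(u)\mid u\in f_G(e)\,\}\!\}\mid e\in E(G),\ v\in f_G(e)\,\}\!\} \] for all $v\in V(G)$ and $i\ge 0$; it distinguishes $G$ and $H$ if there is an $i\ge 0$ with $\{\!\{c^G_i(v)\mid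 v\in V(G)\}\!\}\ne\{\!\{c^H_i(v)\mid v\in V(H)\}\!\}$. Lemma. For all simple hypergraphs $G$ and $H$, the following are equivalent: (1) $\mathsf{InHom}(B,G)=\mathsf{InHom}(B,H)$ for every connected Berge-acyclic simple hypergraph $B$; (2) colour refinement does not distinguish $G$ and $H$. -/

import Mathlib

universe uV uE uV' uE'

/-- A hypergraph with vertex set `V` and edge set `E`: an incidence function that assigns a
non-empty set of vertices to every edge. Parallel edges are allowed.
Finiteness of `V` and `E` is imposed where hypergraphs are quantified over. -/
structure MultiHypergraph (V : Type uV) (E : Type uE) where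
  inc : E → Finset V
  inc_nonempty : ∀ e, (inc e).Nonempty

namespace MultiHypergraph

/-- A hypergraph is simple if it has no parallel edges. -/
def IsSimple {V : Type uV} {E : Type uE} (G : MultiHypergraph V E) : Prop :=
  Function.Injective G.inc

/-- The incidence graph, on the disjoint union of the vertices and the edges;
`v` and `e` are adjacent iff `v` belongs to `e`. -/
def incidenceGraph {V : Type uV} {E : Type uE} (G : MultiHypergraph V E) :
    SimpleGraph (V ⊕ E) where
  Adj x y := (∃ v e, v ∈ G.inc e ∧ x = Sum.inl v ∧ y = Sum.inr e) ∨
    (∃ v e, v ∈ G.inc e ∧ x = Sum.inr e ∧ y = Sum.inl v)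
  symm := ⟨by
    rintro x y (⟨v, e, h, hx, hy⟩ | ⟨v, e, h, hx, hy⟩)
    · exact Or.inr ⟨v, e, h, hy, hx⟩
    · exact Or.inl ⟨v, e, h, hy, hx⟩⟩
  loopless := ⟨by
    rintro x (⟨v, e, h, hx, hy⟩ | ⟨v, e, h, hx, hy⟩)
    · exact Sum.inl_ne_inr (hx.symm.trans hy)
    · exact Sum.inr_ne_inl (hx.symm.trans hy)⟩

/-- A hypergraph is connected if its incidence graph is connected. -/
def IsConnected {V : Type uV} {E : Type uE} (G : MultiHypergraph V E) : Prop :=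
  G.incidenceGraph.Connected

/-- A hypergraph is Berge-acyclic if its incidence graph is acyclic. -/
def IsBergeAcyclic {V : Type uV} {E : Type uE} (G : MultiHypergraph V E) : Prop :=
  G.incidenceGraph.IsAcyclic

/-- An incidence homomorphism from `F` to `G`: a pair of maps on vertices and on edges such that
the image of every edge, as a set of vertices, is contained in the edge it is sent to. -/
def IsIncidenceHom {V : Type uV} {E : Type uE} {V' : Type uV'} {E' : Type uE'}
    (F : MultiHypergraph V E) (G : MultiHypergraph V' E') (h : (V → V') × (E → E')) : Prop :=
  ∀ e : E, h.1 '' (F.inc e : Set V) ⊆ (G.inc (h.2 e) : Set V')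

/-- The number of incidence homomorphisms from `F` to `G` (for finite `F` and `G`). -/
noncomputable def inHom {V : Type uV} {E : Type uE} {V' : Type uV'} {E' : Type uE'}
    (F : MultiHypergraph V E) (G : MultiHypergraph V' E') : ℕ :=
  Nat.card {h : (V → V') × (E → E') // F.IsIncidenceHom G h}

/-- The possible colours of vertices after `i` rounds of colour refinement. -/
def Colour : ℕ → Type
  | 0 => Unit
  | i + 1 => Multiset (Multiset (Colour i))

open Classical in
/-- Colour refinement: all vertices have the same initial colour, and the next colour of `v` is the
multiset, over the edges `e` containing `v`, of the multisets of the current colours of the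
vertices of `e`. -/
noncomputable def colour {V : Type uV} {E : Type uE} [Fintype E] (G : MultiHypergraph V E) :
    (i : ℕ) → V → Colour i
  | 0 => fun _ => ()
  | i + 1 => fun v =>
      ((Finset.univ.filter fun e : E => v ∈ G.inc e).val.map fun e =>
        (G.inc e).val.map (G.colour i) : Multiset (Multiset (Colour i)))

/-- Colour refinement distinguishes `G` and `H` if in some round the multisets of vertex colours
of `G` and of `H` differ. -/
def ColourRefinementDistinguishes {V : Type uV} {E : Type uE} {V' : Type uV'} {E' : Type uE'}
    [Fintype V] [Fintype E] [Fintype V'] [Fintype E']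
    (G : MultiHypergraph V E) (H : MultiHypergraph V' E') : Prop :=
  ∃ i : ℕ, (Finset.univ : Finset V).val.map (G.colour i) ≠
    (Finset.univ : Finset V').val.map (H.colour i)

end MultiHypergraph

/-! Incidence homomorphisms from `B` are the side-preserving homomorphisms between incidence graphs,
and the incidence graph of a connected Berge-acyclic `B` is a tree.

From colours to counts: let every node of the tree carry a weight on the target. Deleting a leaf
multiplies the weight of its neighbour by the neighbour sum of the leaf's weight, so the count
shrinks to a single total sum (`IsTree.homSum_eq`). Starting from weights that depend only on the
side, all weights that occur are functions of the colours in some round, the same functions for `G`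
and `H` (`SameColourWeights`). Their total sums agree: on vertices because the colour multisets
agree, on edges after spreading the weight of each edge evenly over its vertices.

From counts to colours: work in the disjoint union of `G` and `H`. Gluing rooted trees at their
roots multiplies their counting functions, so the span of these functions is an algebra, and by
interpolation it contains every function on one side that is constant where the counts do not
separate points (`mem_countSpan_of_separation`). By induction on the round, counts determine
colours, so the indicator of a colour is a linear combination of counting functions. Each of these
has equal sums over the vertices of `G` and of `H`, hence the colour is equally frequent in both.

Only trees of simple hypergraphs may be used. In `IsBranching` trees every edge node other than the
root has two neighbours, and in an acyclic incidence graph two edges cannot share two vertices, so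
parallel edges are impossible. -/

/-! ### Weighted homomorphism sums and leaf removal in trees -/

namespace SimpleGraph

/-- The sum of a function over the neighbours of a vertex. -/
noncomputable def neighborSum {Ω : Type*} [Fintype Ω] (X : SimpleGraph Ω) (f : Ω → ℚ) (x : Ω) : ℚ :=
  open Classical in ∑ y, if X.Adj x y then f y else 0

/-- The total weight of the homomorphisms from `T` to `X`, where sending `w` to `x` has
weight `φ w x`. -/
noncomputable def homSum {W Ω : Type*} [Fintype W] [Fintype Ω] (T : SimpleGraph W)
    (X : SimpleGraph Ω) (φ : W → Ω → ℚ) : ℚ :=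
  open Classical in
  ∑ h : W → Ω, if ∀ a b, T.Adj a b → X.Adj (h a) (h b) then ∏ w, φ w (h w) else 0

/-- The total weight of the homomorphisms from `T` to `X` sending `r` to `x`. -/
noncomputable def rootedHomSum {W Ω : Type*} [Fintype W] [Fintype Ω] (T : SimpleGraph W)
    (X : SimpleGraph Ω) (φ : W → Ω → ℚ) (r : W) (x : Ω) : ℚ :=
  open Classical in
  ∑ h : W → Ω, if h r = x then
    (if ∀ a b, T.Adj a b → X.Adj (h a) (h b) then ∏ w, φ w (h w) else 0) else 0

section

variable {W W₁ W₂ Ω : Type*} [Fintype W] [Fintype W₁] [Fintype W₂] [Fintype Ω]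
  (X : SimpleGraph Ω)

theorem homSum_eq_sum_rootedHomSum (T : SimpleGraph W) (φ : W → Ω → ℚ) (r : W) :
    T.homSum X φ = ∑ x, T.rootedHomSum X φ r x := by
  classical
  unfold homSum rootedHomSum
  rw [Finset.sum_comm]
  refine Finset.sum_congr rfl fun h _ => ?_
  simp

theorem homSum_iso {T₁ : SimpleGraph W₁} {T₂ : SimpleGraph W₂} (i : T₁ ≃g T₂)
    (φ : W₂ → Ω → ℚ) : T₁.homSum X (fun w => φ (i w)) = T₂.homSum X φ := by
  classical
  unfold homSum
  refine Fintype.sum_equiv (i.toEquiv.arrowCongr (Equiv.refl Ω)) _ _ fun h => ?_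
  have h1 : (∀ a b, T₁.Adj a b → X.Adj (h a) (h b)) ↔
      ∀ a b, T₂.Adj a b → X.Adj (h (i.symm a)) (h (i.symm b)) := by
    constructor
    · intro H a b hab
      exact H _ _ (i.symm.map_rel_iff.2 hab)
    · intro H a b hab
      simpa using H _ _ (i.map_rel_iff.2 hab)
  have h2 : ∏ w, φ (i w) (h w) = ∏ w, φ w (h (i.symm w)) :=
    Fintype.prod_equiv i.toEquiv _ _ fun w => by simp
  simp only [h1, h2]
  rfl

theorem rootedHomSum_unique [Unique W] (T : SimpleGraph W) (φ : W → Ω → ℚ) (r : W) (x : Ω) :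
    T.rootedHomSum X φ r x = φ r x := by
  classical
  unfold rootedHomSum
  rw [Finset.sum_eq_single (fun _ => x)]
  · have : ∀ a b, T.Adj a b → X.Adj x x := fun a b h =>
      (T.ne_of_adj h (Subsingleton.elim a b)).elim
    simp [Subsingleton.elim r default]
  · intro h _ hne
    rw [if_neg]
    intro hr
    exact hne (funext fun w => by rw [Subsingleton.elim w r, hr])
  · simp

omit [Fintype W₁] [Fintype W₂] [Fintype Ω] in
theorem sum_sup_edge_hom_iff (S : SimpleGraph W₁) (T : SimpleGraph W₂) (r₁ : W₁) (r₂ : W₂)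
    (h : W₁ ⊕ W₂ → Ω) :
    (∀ a b, ((S ⊕g T) ⊔ edge (Sum.inl r₁) (Sum.inr r₂)).Adj a b → X.Adj (h a) (h b)) ↔
      (∀ a b, S.Adj a b → X.Adj (h (Sum.inl a)) (h (Sum.inl b))) ∧
      (∀ a b, T.Adj a b → X.Adj (h (Sum.inr a)) (h (Sum.inr b))) ∧
      X.Adj (h (Sum.inl r₁)) (h (Sum.inr r₂)) := by
  constructor
  · intro H
    refine ⟨fun a b hab => H _ _ (by simp [hab]), fun a b hab => H _ _ (by simp [hab]),
      H _ _ (by simp [edge_adj])⟩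
  · rintro ⟨H1, H2, H3⟩ (a | a) (b | b) hab
    · simp [edge_adj] at hab; exact H1 _ _ hab
    · simp [edge_adj] at hab; obtain ⟨rfl, rfl⟩ := hab; exact H3
    · simp [edge_adj] at hab; obtain ⟨rfl, rfl⟩ := hab; exact H3.symm
    · simp [edge_adj] at hab; exact H2 _ _ hab

theorem neighborSum_rootedHomSum (T : SimpleGraph W) (φ : W → Ω → ℚ) (r : W) (x : Ω) :
    X.neighborSum (T.rootedHomSum X φ r) x =
      open Classical in
      ∑ h : W → Ω, if X.Adj x (h r) then
        (if ∀ a b, T.Adj a b → X.Adj (h a) (h b) then ∏ w, φ w (h w) else 0) else 0 := by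
  classical
  unfold neighborSum rootedHomSum
  have : ∀ y, (if X.Adj x y then ∑ h : W → Ω, if h r = y then
    (if ∀ a b, T.Adj a b → X.Adj (h a) (h b) then ∏ w, φ w (h w) else 0) else 0 else 0) =
    ∑ h : W → Ω, if X.Adj x y then if h r = y then
    (if ∀ a b, T.Adj a b → X.Adj (h a) (h b) then ∏ w, φ w (h w) else 0) else 0 else 0 := by
    intro y; split_ifs <;> simp
  simp only [this]
  rw [Finset.sum_comm]
  refine Finset.sum_congr rfl fun h _ => ?_
  rw [Finset.sum_eq_single (h r)]
  · simp
  · intro y _ hy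
    simp [hy.symm]
  · simp

theorem sum_sumArrow_mul [DecidableEq W₁] [DecidableEq W₂] [DecidableEq (W₁ ⊕ W₂)]
    (F : (W₁ → Ω) → ℚ) (G : (W₂ → Ω) → ℚ) :
    ∑ h : W₁ ⊕ W₂ → Ω, F (fun w => h (Sum.inl w)) * G (fun w => h (Sum.inr w)) =
      (∑ h, F h) * ∑ h, G h := by
  rw [Fintype.sum_mul_sum]
  exact (Fintype.sum_equiv (Equiv.sumArrowEquivProdArrow W₁ W₂ Ω) _ (fun p => F p.1 * G p.2)
    fun h => rfl).trans (Fintype.sum_prod_type _)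

/-- The two parts interact only through the adjacency of the images of `r₁` and `r₂`. Once `r₁` is
sent to `x`, the sum factors, and the second factor lets the image of `r₂` range over the neighbours
of `x`. -/
theorem rootedHomSum_sum_sup_edge (S : SimpleGraph W₁) (T : SimpleGraph W₂) (r₁ : W₁) (r₂ : W₂)
    (φ : W₁ ⊕ W₂ → Ω → ℚ) (x : Ω) :
    ((S ⊕g T) ⊔ edge (Sum.inl r₁) (Sum.inr r₂)).rootedHomSum X φ (Sum.inl r₁) x =
      S.rootedHomSum X (fun w => φ (Sum.inl w)) r₁ x *
        X.neighborSum (T.rootedHomSum X (fun w => φ (Sum.inr w)) r₂) x := by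
  classical
  rw [neighborSum_rootedHomSum]
  unfold rootedHomSum
  rw [← sum_sumArrow_mul]
  refine Finset.sum_congr (by congr!) fun h _ => ?_
  rw [Fintype.prod_sum_type]
  simp only [sum_sup_edge_hom_iff]
  by_cases h0 : h (Sum.inl r₁) = x
  · subst h0
    split_ifs <;> simp_all
  · simp [h0]

/-- This absorbs the contribution of a deleted leaf into the weight of the node it was attached to.
-/
theorem rootedHomSum_weight_mul (T : SimpleGraph W) [DecidableEq W] (φ : W → Ω → ℚ) (r : W)
    (g : Ω → ℚ) (x : Ω) :
    T.rootedHomSum X φ r x * g x =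
      T.rootedHomSum X (Function.update φ r fun y => φ r y * g y) r x := by
  classical
  unfold rootedHomSum
  rw [Finset.sum_mul]
  refine Finset.sum_congr rfl fun h _ => ?_
  by_cases h0 : h r = x
  · subst h0
    have : ∏ w, Function.update φ r (fun y => φ r y * g y) w (h w) =
        (∏ w, φ w (h w)) * g (h r) := by
      rw [← Finset.mul_prod_erase _ _ (Finset.mem_univ r),
        ← Finset.mul_prod_erase _ (fun w => φ w (h w)) (Finset.mem_univ r)]
      rw [Finset.prod_congr rfl (g := fun w => φ w (h w))]
      · simp; ring
      · intro w hw
        rw [Function.update_of_ne (Finset.ne_of_mem_erase hw)]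
    rw [this]
    split_ifs <;> simp
  · simp [h0]

end

/-- A walk in the sum never leaves the summand in which it starts, so a bridge of a summand remains
a bridge. -/
theorem IsAcyclic.sum {W₁ W₂ : Type*} {S : SimpleGraph W₁} {T : SimpleGraph W₂}
    (hS : S.IsAcyclic) (hT : T.IsAcyclic) : (S ⊕g T).IsAcyclic := by
  rw [isAcyclic_iff_forall_adj_isBridge] at *
  rintro (a | a) (b | b) hab
  · simp only [sum_adj_inl] at hab
    rw [isBridge_iff]
    intro hr
    refine (isBridge_iff.1 (hS hab)) ?_
    rw [reachable_iff_reflTransGen] at hr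
    have : ∀ y, Relation.ReflTransGen
        ((S ⊕g T).deleteEdges {s(Sum.inl a, Sum.inl b)}).Adj (Sum.inl a) y →
        ∃ c, y = Sum.inl c ∧ (S.deleteEdges {s(a, b)}).Reachable a c := by
      intro y hy
      induction hy with
      | refl => exact ⟨a, rfl, Reachable.refl _⟩
      | @tail y z _ hyz ih =>
        obtain ⟨c, rfl, hc⟩ := ih
        rcases z with d | d
        · refine ⟨d, rfl, hc.trans (Adj.reachable ?_)⟩
          simpa [deleteEdges_adj] using hyz
        · simp [deleteEdges_adj] at hyz
    obtain ⟨c, hc, h⟩ := this _ hr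
    cases hc
    exact h
  · simp at hab
  · simp at hab
  · simp only [sum_adj_inr] at hab
    rw [isBridge_iff]
    intro hr
    refine (isBridge_iff.1 (hT hab)) ?_
    rw [reachable_iff_reflTransGen] at hr
    have : ∀ y, Relation.ReflTransGen
        ((S ⊕g T).deleteEdges {s(Sum.inr a, Sum.inr b)}).Adj (Sum.inr a) y →
        ∃ c, y = Sum.inr c ∧ (T.deleteEdges {s(a, b)}).Reachable a c := by
      intro y hy
      induction hy with
      | refl => exact ⟨a, rfl, Reachable.refl _⟩
      | @tail y z _ hyz ih =>
        obtain ⟨c, rfl, hc⟩ := ih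
        rcases z with d | d
        · simp [deleteEdges_adj] at hyz
        · refine ⟨d, rfl, hc.trans (Adj.reachable ?_)⟩
          simpa [deleteEdges_adj] using hyz
    obtain ⟨c, hc, h⟩ := this _ hr
    cases hc
    exact h

theorem IsTree.sum_sup_edge {W₁ W₂ : Type*} {S : SimpleGraph W₁} {T : SimpleGraph W₂}
    (hS : S.IsTree) (hT : T.IsTree) (r₁ : W₁) (r₂ : W₂) :
    ((S ⊕g T) ⊔ edge (Sum.inl r₁) (Sum.inr r₂)).IsTree :=
  ⟨hS.1.sum_sup_edge hT.1,
    (hS.2.sum hT.2).sup_edge_of_not_reachable (not_reachable_sum_inl_inr _ _)⟩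

theorem homSum_sup_edge_leaf {W W' Ω : Type*} [Fintype W] [Fintype W'] [DecidableEq W'] [Fintype Ω]
    (X : SimpleGraph Ω) {T : SimpleGraph W} {T' : SimpleGraph W'} (p : W')
    (i : ((T' ⊕g (⊥ : SimpleGraph Unit)) ⊔ edge (Sum.inl p) (Sum.inr ())) ≃g T)
    (φ : W → Ω → ℚ) :
    T.homSum X φ = T'.homSum X (Function.update (fun w => φ (i (Sum.inl w))) p
      fun y => φ (i (Sum.inl p)) y * X.neighborSum (φ (i (Sum.inr ()))) y) := by
  rw [← homSum_iso X i φ, homSum_eq_sum_rootedHomSum X _ _ (Sum.inl p),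
    homSum_eq_sum_rootedHomSum X T' _ p]
  refine Finset.sum_congr rfl fun x _ => ?_
  rw [rootedHomSum_sum_sup_edge, rootedHomSum_weight_mul]
  congr 2
  funext y
  congr 2
  funext z
  rw [rootedHomSum_unique]

/-- A finite tree with at least two vertices arises from a smaller tree by adding a leaf. -/
theorem IsTree.exists_sup_edge_leaf {W : Type*} [Fintype W] [Nontrivial W] {T : SimpleGraph W}
    (hT : T.IsTree) : ∃ (s : Finset W) (p : s) (T' : SimpleGraph s), T'.IsTree ∧
      Fintype.card s < Fintype.card W ∧
      Nonempty (((T' ⊕g (⊥ : SimpleGraph Unit)) ⊔ edge (Sum.inl p) (Sum.inr ())) ≃g T) := by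
  classical
  obtain ⟨l, hl⟩ := hT.exists_vert_degree_one_of_nontrivial
  obtain ⟨p, hp, hpu⟩ := (degree_eq_one_iff_existsUnique_adj).1 hl
  have hconn := hT.1.induce_compl_singleton_of_degree_eq_one hl
  have hs : (({l}ᶜ : Finset W) : Set W) = ({l}ᶜ : Set W) := by simp
  rw [← hs] at hconn
  have hpl : p ∈ ({l}ᶜ : Finset W) := by simpa using (T.ne_of_adj hp).symm
  let e : ({l}ᶜ : Finset W) ⊕ Unit ≃ W :=
    { toFun := Sum.elim Subtype.val fun _ => l
      invFun := fun w => if h : w = l then Sum.inr () else Sum.inl ⟨w, by simpa using h⟩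
      left_inv := by
        rintro (⟨w, hw⟩ | _)
        · have : w ≠ l := by simpa using hw
          simp [this]
        · simp
      right_inv := by
        intro w
        by_cases h : w = l <;> simp [h] }
  refine ⟨{l}ᶜ, ⟨p, hpl⟩, T.induce (({l}ᶜ : Finset W) : Set W), ⟨hconn, hT.2.induce _⟩, ?_,
    ⟨⟨e, ?_⟩⟩⟩
  · rw [Fintype.card_coe]
    exact Finset.card_lt_univ_of_notMem (x := l) (by simp)
  · rintro (⟨a, ha⟩ | a) (⟨b, hb⟩ | b)
    · simp [e, edge_adj]
    · simp only [Equiv.coe_fn_mk, Sum.elim_inl, Sum.elim_inr, e]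
      constructor
      · intro h
        have := hpu a h.symm
        subst this
        simp [edge_adj]
      · intro h
        simp [edge_adj] at h
        rw [h]; exact hp.symm
    · simp only [Equiv.coe_fn_mk, Sum.elim_inl, Sum.elim_inr, e]
      constructor
      · intro h
        have := hpu b h
        subst this
        simp [edge_adj]
      · intro h
        simp [edge_adj] at h
        rw [h]; exact hp
    · simp [e]

/-- Homomorphism sums of trees agree on two graphs if the weights are related by a relation
that is compatible with products, neighbour sums and total sums. -/
theorem IsTree.homSum_eq {Ω Ω' : Type*} [Fintype Ω] [Fintype Ω'] (X : SimpleGraph Ω)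
    (Y : SimpleGraph Ω') (R : (Ω → ℚ) → (Ω' → ℚ) → Prop)
    (hmul : ∀ f f' g g', R f f' → R g g' → R (fun x => f x * g x) (fun x => f' x * g' x))
    (hnbr : ∀ f f', R f f' → R (X.neighborSum f) (Y.neighborSum f'))
    (hsum : ∀ f f', R f f' → ∑ x, f x = ∑ x, f' x)
    {W : Type*} [Fintype W] (T : SimpleGraph W) (hT : T.IsTree) (φ : W → Ω → ℚ) (ψ : W → Ω' → ℚ)
    (hφ : ∀ w, R (φ w) (ψ w)) : T.homSum X φ = T.homSum Y ψ := by
  classical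
  induction hn : Fintype.card W using Nat.strong_induction_on generalizing W with
  | _ n ih =>
  subst hn
  rcases subsingleton_or_nontrivial W with hW | hW
  · obtain ⟨r⟩ := hT.1.nonempty
    have : Unique W := ⟨⟨r⟩, fun _ => Subsingleton.elim _ _⟩
    rw [homSum_eq_sum_rootedHomSum X T φ r, homSum_eq_sum_rootedHomSum Y T ψ r]
    simp only [rootedHomSum_unique]
    exact hsum _ _ (hφ r)
  · obtain ⟨s, p, T', hT', hlt, ⟨i⟩⟩ := hT.exists_sup_edge_leaf
    rw [homSum_sup_edge_leaf X p i, homSum_sup_edge_leaf Y p i]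
    refine ih _ hlt T' hT' _ _ (fun w => ?_) rfl
    by_cases hw : w = p
    · subst hw
      simp only [Function.update_self]
      exact hmul _ _ _ _ (hφ _) (hnbr _ _ (hφ _))
    · simp only [Function.update_of_ne hw]
      exact hφ _

end SimpleGraph

/-! ### Interpolation in a space of functions closed under products -/

/-- Let `S` be a space of functions on a finite set that is closed under products and contains `u`.
Every function that is supported in the support of `u` and constant on sets on which all members
of `S` are constant belongs to `S`. -/
theorem Submodule.mem_of_separation {Ω : Type*} [Fintype Ω] (S : Submodule ℚ (Ω → ℚ))
    (hmul : ∀ f ∈ S, ∀ g ∈ S, f * g ∈ S) {u : Ω → ℚ} (hu : u ∈ S) (g : Ω → ℚ)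
    (hsupp : ∀ x, u x = 0 → g x = 0)
    (hconst : ∀ x y, u x ≠ 0 → u y ≠ 0 → (∀ f ∈ S, f x = f y) → g x = g y) : g ∈ S := by
  classical
  -- Starting from `u`, the points of `s` that can be separated from `x` are made zeros one at a
  -- time.
  have h1 : ∀ x, u x ≠ 0 → ∀ s : Finset Ω, ∃ p ∈ S, p x ≠ 0 ∧ (∀ y, u y = 0 → p y = 0) ∧
      ∀ y ∈ s, (∃ f ∈ S, f x ≠ f y) → p y = 0 := by
    intro x hx s
    induction s using Finset.induction_on with
    | empty => exact ⟨u, hu, hx, fun _ h => h, by simp⟩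
    | insert a s _ ih =>
      obtain ⟨p, hp, hpx, hpu, hps⟩ := ih
      by_cases ha : ∃ f ∈ S, f x ≠ f a
      · obtain ⟨f, hf, hfa⟩ := ha
        -- The product of `p` with `f - f a`, expanded because `S` need not contain the constants.
        refine ⟨p * f - f a • p, S.sub_mem (hmul _ hp _ hf) (S.smul_mem _ hp), ?_, ?_, ?_⟩
        · have : p x * f x - f a * p x = p x * (f x - f a) := by ring
          simpa [this, hpx, sub_eq_zero] using hfa
        · intro y hy
          simp [hpu y hy]
        · intro y hy hex
          rcases Finset.mem_insert.1 hy with rfl | hy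
          · simp [mul_comm]
          · simp [hps y hy hex]
      · refine ⟨p, hp, hpx, hpu, fun y hy hex => ?_⟩
        rcases Finset.mem_insert.1 hy with rfl | hy
        · exact (ha hex).elim
        · exact hps y hy hex
  have h2 : ∀ x, ∃ p ∈ S, u x ≠ 0 → p x = 1 ∧ (∀ y, u y = 0 → p y = 0) ∧
      ∀ y, (∃ f ∈ S, f x ≠ f y) → p y = 0 := by
    intro x
    by_cases hx : u x = 0
    · exact ⟨0, S.zero_mem, fun h => (h hx).elim⟩
    obtain ⟨p, hp, hpx, hpu, hps⟩ := h1 x hx Finset.univ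
    refine ⟨(p x)⁻¹ • p, S.smul_mem _ hp, fun _ => ⟨?_, ?_, ?_⟩⟩
    · simp [hpx]
    · intro y hy; simp [hpu y hy]
    · intro y hy; simp [hps y (Finset.mem_univ _) hy]
  choose p hp hpx using h2
  let cls : Ω → Finset Ω := fun x => Finset.univ.filter fun y => u y ≠ 0 ∧ ∀ f ∈ S, f x = f y
  -- For `u x ≠ 0`, `p x` is the indicator of the class of `x` in the support of `u`: it belongs to
  -- `S`, so its value 1 at `x` is its value on the whole class. Every class occurs once for each of
  -- its points, hence the division.
  have hg : g = ∑ x, (if u x = 0 then 0 else g x / (cls x).card) • p x := by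
    funext y
    rw [Finset.sum_apply]
    by_cases hy : u y = 0
    · rw [hsupp y hy, Finset.sum_eq_zero]
      intro x _
      by_cases hx : u x = 0
      · simp [hx]
      · simp [(hpx x hx).2.1 y hy]
    · have hterm : ∀ x, ((if u x = 0 then 0 else g x / (cls x).card) • p x) y =
          if x ∈ cls y then g y / (cls y).card else 0 := by
        intro x
        by_cases hx : u x = 0
        · simp [hx, cls]
        by_cases hxy : ∀ f ∈ S, f y = f x
        · have hcls : cls x = cls y := by
            ext z
            simp only [cls, Finset.mem_filter, Finset.mem_univ, true_and]
            constructor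
            · rintro ⟨hz, h⟩; exact ⟨hz, fun f hf => (hxy f hf).trans (h f hf)⟩
            · rintro ⟨hz, h⟩; exact ⟨hz, fun f hf => (hxy f hf).symm.trans (h f hf)⟩
          have hmem : x ∈ cls y := by simp [cls, hx]; exact hxy
          have h1 : p x y = 1 := by rw [hxy _ (hp x)]; exact (hpx x hx).1
          simp [hx, hcls, hmem, h1, hconst x y hx hy fun f hf => (hxy f hf).symm]
        · have hmem : x ∉ cls y := by simp [cls, hx]; simpa using hxy
          push Not at hxy
          obtain ⟨f, hf, hne⟩ := hxy
          have h0 : p x y = 0 := (hpx x hx).2.2 y ⟨f, hf, hne.symm⟩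
          simp [hmem, h0]
      have hpos : ((cls y).card : ℚ) ≠ 0 := by
        have : y ∈ cls y := by simp [cls, hy]
        exact_mod_cast (Finset.card_pos.2 ⟨y, this⟩).ne'
      simp only [hterm]
      rw [Finset.sum_ite_mem]
      simp
      field_simp
  rw [hg]
  exact S.sum_mem fun x _ => S.smul_mem _ (hp x)

theorem Multiset.count_map_finset {α β : Type*} [Fintype α] [DecidableEq α] [DecidableEq β]
    (s : Finset α) (f : α → β) (c : β) :
    ((s.val.map f).count c : ℚ) = ∑ a, if a ∈ s then (if f a = c then 1 else 0) else 0 := by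
  rw [Multiset.count_map, Finset.sum_ite_mem, Finset.univ_inter, Finset.sum_boole,
    ← Finset.filter_val, Finset.card_val]
  simp only [eq_comm]

namespace SimpleGraph

theorem neighborSum_add {Ω : Type*} [Fintype Ω] (X : SimpleGraph Ω) (f g : Ω → ℚ) (x : Ω) :
    X.neighborSum (f + g) x = X.neighborSum f x + X.neighborSum g x := by
  classical
  unfold neighborSum
  rw [← Finset.sum_add_distrib]
  refine Finset.sum_congr rfl fun y _ => ?_
  split_ifs <;> simp

theorem neighborSum_smul {Ω : Type*} [Fintype Ω] (X : SimpleGraph Ω) (c : ℚ) (f : Ω → ℚ) (x : Ω) :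
    X.neighborSum (c • f) x = c * X.neighborSum f x := by
  classical
  unfold neighborSum
  rw [Finset.mul_sum]
  refine Finset.sum_congr rfl fun y _ => ?_
  split_ifs <;> simp

theorem neighborSum_zero {Ω : Type*} [Fintype Ω] (X : SimpleGraph Ω) (x : Ω) :
    X.neighborSum 0 x = 0 := by
  unfold neighborSum
  simp

end SimpleGraph

/-! ### Rooted trees and the span of their counting functions -/

/-- A finite graph with a distinguished vertex and a labelling of its vertices by two sides;
in incidence graphs the side of the vertices is `true` and that of the edges is `false`. -/
structure RootedBigraph where
  W : Type
  [fintype : Fintype W]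
  graph : SimpleGraph W
  root : W
  side : W → Bool

attribute [instance] RootedBigraph.fintype

namespace RootedBigraph

/-- The one-vertex rooted graph. -/
def point (b : Bool) : RootedBigraph where
  W := Unit
  graph := ⊥
  root := ()
  side := fun _ => b

/-- The rooted graph obtained by connecting the roots of two rooted graphs by an edge;
its root is that of the first one. -/
def join (A B : RootedBigraph) : RootedBigraph where
  W := A.W ⊕ B.W
  graph := (A.graph ⊕g B.graph) ⊔ SimpleGraph.edge (Sum.inl A.root) (Sum.inr B.root)
  root := Sum.inl A.root
  side := Sum.elim A.side B.side

/-- Rooted trees in which the root has side `b`, no vertex of side `false` other than the root is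
a leaf, and a root of side `false` has a child. -/
inductive IsBranching : Bool → RootedBigraph → Prop
  | point : IsBranching true (point true)
  | leaf {A : RootedBigraph} : IsBranching true A → IsBranching false (join (.point false) A)
  | join {b : Bool} {A B : RootedBigraph} : IsBranching b A → IsBranching (!b) B →
      IsBranching b (join A B)

open MultiHypergraph

variable {V : Type uV} {E : Type uE} [Fintype V] [Fintype E] (K : MultiHypergraph V E)

/-- The number of homomorphisms to the incidence graph of `K` that respect the sides and
have a given value at the root. -/
noncomputable def count (A : RootedBigraph) : V ⊕ E → ℚ :=
  A.graph.rootedHomSum K.incidenceGraph (fun w x => if A.side w = x.isLeft then 1 else 0) A.root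

theorem count_point (b : Bool) (x : V ⊕ E) :
    (point b).count K x = if b = x.isLeft then 1 else 0 := by
  have : Unique (point b).W := inferInstanceAs (Unique Unit)
  unfold count
  rw [SimpleGraph.rootedHomSum_unique]
  rfl

theorem count_join (A B : RootedBigraph) (x : V ⊕ E) :
    (join A B).count K x = A.count K x * K.incidenceGraph.neighborSum (B.count K) x := by
  unfold count
  exact SimpleGraph.rootedHomSum_sum_sup_edge K.incidenceGraph A.graph B.graph A.root B.root _ x

theorem IsBranching.count_eq_zero {b : Bool} {A : RootedBigraph} (hA : IsBranching b A)
    {x : V ⊕ E} (hx : b ≠ x.isLeft) : A.count K x = 0 := by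
  induction hA with
  | point => rw [count_point, if_neg hx]
  | leaf _ _ => rw [count_join, count_point, if_neg hx, zero_mul]
  | join _ _ ih _ => rw [count_join, ih hx, zero_mul]

/-- Identifying the two roots multiplies the counts. The induction on `B` realises this by moving
the branches at the root of `B` to the root of `A`. -/
theorem IsBranching.exists_count_mul {b : Bool} {A B : RootedBigraph} (hA : IsBranching b A)
    (hB : IsBranching b B) : ∃ C, IsBranching b C ∧ C.count K = A.count K * B.count K := by
  induction hB with
  | point =>
    refine ⟨A, hA, funext fun x => ?_⟩
    by_cases hx : true = x.isLeft
    · simp [count_point, ← hx]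
    · simp [hA.count_eq_zero K hx]
  | @leaf B hB _ =>
    refine ⟨A.join B, hA.join hB, funext fun x => ?_⟩
    by_cases hx : false = x.isLeft
    · simp [count_join, count_point, ← hx]
    · simp [count_join, hA.count_eq_zero K hx]
  | @join b B D hB hD ih _ =>
    obtain ⟨C, hC, hCe⟩ := ih hA
    refine ⟨C.join D, hC.join hD, funext fun x => ?_⟩
    simp [count_join, hCe, mul_assoc]

/-- The span of the counting functions of the branching trees with root of side `b`. -/
noncomputable def countSpan (b : Bool) : Submodule ℚ (V ⊕ E → ℚ) :=
  Submodule.span ℚ {f | ∃ A, IsBranching b A ∧ A.count K = f}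

variable {K}

theorem mul_mem_countSpan {b : Bool} {f g : V ⊕ E → ℚ} (hf : f ∈ countSpan K b)
    (hg : g ∈ countSpan K b) : f * g ∈ countSpan K b := by
  induction hf using Submodule.span_induction with
  | mem f hf =>
    obtain ⟨A, hA, rfl⟩ := hf
    induction hg using Submodule.span_induction with
    | mem g hg =>
      obtain ⟨B, hB, rfl⟩ := hg
      obtain ⟨C, hC, h⟩ := hA.exists_count_mul K hB
      exact Submodule.subset_span ⟨C, hC, h⟩
    | zero => rw [mul_zero]; exact Submodule.zero_mem _
    | add g g' _ _ h h' => rw [mul_add]; exact Submodule.add_mem _ h h'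
    | smul c g _ h => rw [mul_smul_comm]; exact Submodule.smul_mem _ _ h
  | zero => rw [zero_mul]; exact Submodule.zero_mem _
  | add f f' _ _ h h' => rw [add_mul]; exact Submodule.add_mem _ h h'
  | smul c f _ h => rw [smul_mul_assoc]; exact Submodule.smul_mem _ _ h

/-- On trees, this is the attachment of a new root of side `b` above the old one; the new node also
cuts the function off to its own side. -/
theorem neighborSum_mem_countSpan {b : Bool} {f : V ⊕ E → ℚ} (hf : f ∈ countSpan K (!b)) :
    (fun x => if b = x.isLeft then K.incidenceGraph.neighborSum f x else 0) ∈ countSpan K b := by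
  induction hf using Submodule.span_induction with
  | mem f hf =>
    obtain ⟨A, hA, rfl⟩ := hf
    refine Submodule.subset_span ⟨(point b).join A, ?_, funext fun x => ?_⟩
    · cases b
      · exact hA.leaf
      · exact IsBranching.point.join hA
    · simp [count_join, count_point]
  | zero =>
    simp only [SimpleGraph.neighborSum_zero, ite_self]
    exact Submodule.zero_mem _
  | add f f' _ _ h h' =>
    convert Submodule.add_mem _ h h' using 1
    funext x
    by_cases hx : b = x.isLeft <;> simp [hx, SimpleGraph.neighborSum_add]
  | smul c f _ h =>
    convert Submodule.smul_mem _ c h using 1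
    funext x
    by_cases hx : b = x.isLeft <;> simp [hx, SimpleGraph.neighborSum_smul]

theorem eq_of_mem_countSpan {b : Bool} {f : V ⊕ E → ℚ} (hf : f ∈ countSpan K b) {x y : V ⊕ E}
    (h : ∀ A, IsBranching b A → A.count K x = A.count K y) : f x = f y := by
  induction hf using Submodule.span_induction with
  | mem f hf => obtain ⟨A, hA, rfl⟩ := hf; exact h A hA
  | zero => rfl
  | add f f' _ _ h h' => simp [h, h']
  | smul c f _ h => simp [h]

end RootedBigraph

/-! ### Tree counts determine colours -/

namespace MultiHypergraph

variable {V : Type uV} {E : Type uE} [Fintype V] [Fintype E] (K : MultiHypergraph V E)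

theorem incidenceGraph_adj_inl_inr {V : Type uV} {E : Type uE} (K : MultiHypergraph V E) (v : V)
    (e : E) : K.incidenceGraph.Adj (Sum.inl v) (Sum.inr e) ↔ v ∈ K.inc e := by
  simp [incidenceGraph]

theorem incidenceGraph_adj_inr_inl {V : Type uV} {E : Type uE} (K : MultiHypergraph V E) (v : V)
    (e : E) : K.incidenceGraph.Adj (Sum.inr e) (Sum.inl v) ↔ v ∈ K.inc e := by
  simp [incidenceGraph]

theorem not_incidenceGraph_adj_inl_inl {V : Type uV} {E : Type uE} (K : MultiHypergraph V E)
    (v w : V) : ¬ K.incidenceGraph.Adj (Sum.inl v) (Sum.inl w) := by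
  simp [incidenceGraph]

theorem not_incidenceGraph_adj_inr_inr {V : Type uV} {E : Type uE} (K : MultiHypergraph V E)
    (e f : E) : ¬ K.incidenceGraph.Adj (Sum.inr e) (Sum.inr f) := by
  simp [incidenceGraph]

open Classical in
theorem neighborSum_inl (f : V ⊕ E → ℚ) (v : V) :
    K.incidenceGraph.neighborSum f (Sum.inl v) =
      ∑ e, if v ∈ K.inc e then f (Sum.inr e) else 0 := by
  unfold SimpleGraph.neighborSum
  simp [incidenceGraph_adj_inl_inr, not_incidenceGraph_adj_inl_inl]

open Classical in
theorem neighborSum_inr (f : V ⊕ E → ℚ) (e : E) :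
    K.incidenceGraph.neighborSum f (Sum.inr e) =
      ∑ v, if v ∈ K.inc e then f (Sum.inl v) else 0 := by
  unfold SimpleGraph.neighborSum
  simp [incidenceGraph_adj_inr_inl, not_incidenceGraph_adj_inr_inr]

/-- The multiset of the colours of the vertices of an edge. -/
noncomputable def edgeColour (i : ℕ) (e : E) : Multiset (Colour i) :=
  (K.inc e).val.map (K.colour i)

open RootedBigraph

variable {K}

theorem mem_countSpan_of_separation {b : Bool} (g : V ⊕ E → ℚ)
    (hsupp : ∀ x, b ≠ x.isLeft → g x = 0)
    (hconst : ∀ x y, b = x.isLeft → b = y.isLeft →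
      (∀ A, IsBranching b A → A.count K x = A.count K y) → g x = g y) :
    g ∈ countSpan K b := by
  classical
  have htrue : (point true).count K ∈ countSpan K true :=
    Submodule.subset_span ⟨_, .point, rfl⟩
  -- A single edge node is not a branching tree, so the indicator of the edge side is not directly
  -- available. Its substitute is the size of an edge, which vanishes nowhere on that side since
  -- edges are non-empty.
  obtain ⟨u, hu, hub⟩ : ∃ u ∈ countSpan K b, ∀ x, u x ≠ 0 ↔ b = x.isLeft := by
    cases b
    · refine ⟨_, neighborSum_mem_countSpan (b := false) htrue, ?_⟩
      rintro (v | e)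
      · simp
      · simp only [Sum.isLeft_inr, if_true, iff_true, neighborSum_inr, count_point, Sum.isLeft_inl]
        simpa using (K.inc_nonempty e).ne_empty
    · exact ⟨_, htrue, fun x => by simp [count_point]⟩
  refine Submodule.mem_of_separation _ (fun f hf g hg => mul_mem_countSpan hf hg) hu g ?_ ?_
  · intro x hx
    exact hsupp x fun h => (hub x).2 h hx
  · intro x y hx hy h
    exact hconst x y ((hub x).1 hx) ((hub y).1 hy)
      fun A hA => h _ (Submodule.subset_span ⟨A, hA, rfl⟩)

/-- The multiplicity of `c` in the colour of an edge is the neighbour sum of the indicator of `c`.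
That indicator lies in the span by `hi` and separation, so the multiplicity is a combination of
counts at the edge. The passage from edges back to vertices is dual. -/
theorem edgeColour_eq_of_count_eq {i : ℕ}
    (hi : ∀ v w : V, (∀ A, IsBranching true A → A.count K (Sum.inl v) = A.count K (Sum.inl w)) →
      K.colour i v = K.colour i w) {e f : E}
    (h : ∀ A, IsBranching false A → A.count K (Sum.inr e) = A.count K (Sum.inr f)) :
    K.edgeColour i e = K.edgeColour i f := by
  classical
  refine Multiset.ext.2 fun c => ?_
  have hg : (Sum.elim (fun v => if K.colour i v = c then 1 else 0) fun _ => 0 : V ⊕ E → ℚ) ∈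
      countSpan K true := by
    refine mem_countSpan_of_separation _ ?_ ?_
    · rintro (v | e) hx
      · simp at hx
      · rfl
    · rintro (v | e) (w | e) hx hy hxy
      · simp only [Sum.elim_inl, hi v w hxy]
      all_goals simp at hx hy
  have := eq_of_mem_countSpan (neighborSum_mem_countSpan (b := false) hg) h
  simp only [Sum.isLeft_inr, if_true, neighborSum_inr, Sum.elim_inl] at this
  unfold edgeColour
  rw [← Multiset.count_map_finset, ← Multiset.count_map_finset] at this
  exact_mod_cast this

theorem colour_succ_eq_of_count_eq {i : ℕ}
    (hi : ∀ e f : E, (∀ A, IsBranching false A → A.count K (Sum.inr e) = A.count K (Sum.inr f)) →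
      K.edgeColour i e = K.edgeColour i f) {v w : V}
    (h : ∀ A, IsBranching true A → A.count K (Sum.inl v) = A.count K (Sum.inl w)) :
    K.colour (i + 1) v = K.colour (i + 1) w := by
  classical
  refine (Multiset.ext (α := Multiset (Colour i))).2 fun c => ?_
  have hg : (Sum.elim (fun _ => 0) fun e => if K.edgeColour i e = c then 1 else 0 : V ⊕ E → ℚ) ∈
      countSpan K false := by
    refine mem_countSpan_of_separation _ ?_ ?_
    · rintro (v | e) hx
      · rfl
      · simp at hx
    · rintro (v | e) (w | f) hx hy hxy
      case inr.inr => simp only [Sum.elim_inr, hi e f hxy]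
      all_goals simp at hx hy
  have := eq_of_mem_countSpan (neighborSum_mem_countSpan (b := true) hg) h
  simp only [Sum.isLeft_inl, if_true, neighborSum_inl, Sum.elim_inr] at this
  have key : ∀ v, (Multiset.count c (K.colour (i + 1) v : Multiset (Multiset (Colour i))) : ℚ) =
      ∑ e, if v ∈ K.inc e then (if K.edgeColour i e = c then 1 else 0) else 0 := by
    intro v
    have := Multiset.count_map_finset (Finset.univ.filter fun e => v ∈ K.inc e) (K.edgeColour i) c
    simp only [Finset.mem_filter, Finset.mem_univ, true_and] at this
    exact this
  rw [← key, ← key] at this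
  exact_mod_cast this

theorem colour_eq_of_count_eq (i : ℕ) (v w : V)
    (h : ∀ A, IsBranching true A → A.count K (Sum.inl v) = A.count K (Sum.inl w)) :
    K.colour i v = K.colour i w := by
  induction i generalizing v w with
  | zero => rfl
  | succ i ih => exact colour_succ_eq_of_count_eq (fun e f => edgeColour_eq_of_count_eq ih) h

/-- The indicator function of a colour is a combination of counting functions. -/
theorem colourIndicator_mem_countSpan (i : ℕ) (c : Colour i) :
    open Classical in
    (Sum.elim (fun v => if K.colour i v = c then 1 else 0) fun _ => 0 : V ⊕ E → ℚ) ∈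
      countSpan K true := by
  refine mem_countSpan_of_separation _ ?_ ?_
  · rintro (v | e) hx
    · simp at hx
    · rfl
  · rintro (v | e) (w | e) hx hy hxy
    · rw [Sum.elim_inl, Sum.elim_inl, colour_eq_of_count_eq i v w hxy]
    all_goals simp at hx hy

end MultiHypergraph

/-! ### Incidence homomorphisms as homomorphisms of incidence graphs -/

namespace MultiHypergraph

open RootedBigraph

/-- The incidence homomorphisms are the side-preserving homomorphisms of incidence graphs. -/
theorem inHom_eq_homSum {VB EB : Type*} [Fintype VB] [Fintype EB] {V : Type uV} {E : Type uE}
    [Fintype V] [Fintype E] (B : MultiHypergraph VB EB) (G : MultiHypergraph V E) :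
    (B.inHom G : ℚ) = B.incidenceGraph.homSum G.incidenceGraph
      (fun w x => if w.isLeft = x.isLeft then 1 else 0) := by
  classical
  let P : (VB ⊕ EB → V ⊕ E) → Prop := fun h =>
    (∀ a b, B.incidenceGraph.Adj a b → G.incidenceGraph.Adj (h a) (h b)) ∧
      ∀ w, w.isLeft = (h w).isLeft
  have h1 : B.incidenceGraph.homSum G.incidenceGraph
      (fun w x => if w.isLeft = x.isLeft then 1 else 0) = (Nat.card {h // P h} : ℚ) := by
    unfold SimpleGraph.homSum
    rw [Nat.card_eq_fintype_card, Fintype.card_subtype, ← Finset.sum_boole]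
    refine Finset.sum_congr (by congr!) fun h _ => ?_
    rw [Finset.prod_ite_zero, Finset.prod_const_one, ← ite_and]
    simp [P]
  rw [h1]
  unfold inHom
  congr 1
  have hP : ∀ h : (VB → V) × (EB → E), B.IsIncidenceHom G h ↔ P (Sum.map h.1 h.2) := by
    intro h
    constructor
    · intro H
      refine ⟨?_, by rintro (v | e) <;> rfl⟩
      rintro (v | e) (w | f) hab
      · exact (not_incidenceGraph_adj_inl_inl B _ _ hab).elim
      · exact (incidenceGraph_adj_inl_inr G _ _).2
          (H f ⟨v, (incidenceGraph_adj_inl_inr B _ _).1 hab, rfl⟩)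
      · exact (incidenceGraph_adj_inr_inl G _ _).2
          (H e ⟨w, (incidenceGraph_adj_inr_inl B _ _).1 hab, rfl⟩)
      · exact (not_incidenceGraph_adj_inr_inr B _ _ hab).elim
    · rintro ⟨H, _⟩ e _ ⟨v, hv, rfl⟩
      exact (incidenceGraph_adj_inl_inr G _ _).1
        (H (Sum.inl v) (Sum.inr e) ((incidenceGraph_adj_inl_inr B _ _).2 hv))
  refine Nat.card_congr (Equiv.ofBijective
    (fun h => ⟨Sum.map h.1.1 h.1.2, (hP _).1 h.2⟩) ⟨?_, ?_⟩)
  · rintro ⟨⟨a, b⟩, h⟩ ⟨⟨a', b'⟩, h'⟩ heq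
    have heq : Sum.map a b = Sum.map a' b' := congrArg Subtype.val heq
    refine Subtype.ext (Prod.ext (funext fun v => ?_) (funext fun e => ?_))
    · simpa using congrFun heq (Sum.inl v)
    · simpa using congrFun heq (Sum.inr e)
  · rintro ⟨h, hh⟩
    have hl : ∀ v, ∃ x, h (Sum.inl v) = Sum.inl x := fun v =>
      Sum.isLeft_iff.1 (hh.2 (Sum.inl v)).symm
    have hr : ∀ e, ∃ x, h (Sum.inr e) = Sum.inr x := fun e =>
      Sum.isRight_iff.1 (by simpa using (hh.2 (Sum.inr e)).symm)
    choose a ha using hl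
    choose b hb using hr
    have : Sum.map a b = h := funext fun w => by cases w <;> simp [ha, hb]
    refine ⟨⟨(a, b), (hP _).2 (by rw [this]; exact hh)⟩, Subtype.ext this⟩

/-- Distinct edges of a Berge-acyclic hypergraph share at most one vertex. -/
theorem IsBergeAcyclic.edge_unique {V : Type uV} {E : Type uE} {B : MultiHypergraph V E}
    (hB : B.IsBergeAcyclic) {v w : V} (hvw : v ≠ w) {e f : E} (hve : v ∈ B.inc e)
    (hwe : w ∈ B.inc e) (hvf : v ∈ B.inc f) (hwf : w ∈ B.inc f) : e = f := by
  have path : ∀ e, (hve : v ∈ B.inc e) → (hwe : w ∈ B.inc e) →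
      ∃ p : B.incidenceGraph.Path (Sum.inl v) (Sum.inl w), p.1.support = [Sum.inl v, Sum.inr e, Sum.inl w] := by
    intro e hve hwe
    refine ⟨⟨.cons ((incidenceGraph_adj_inl_inr B v e).2 hve)
      (.cons ((incidenceGraph_adj_inr_inl B w e).2 hwe) .nil), ?_⟩, ?_⟩
    · simp [SimpleGraph.Walk.isPath_def, hvw]
    · simp
  obtain ⟨p, hp⟩ := path e hve hwe
  obtain ⟨q, hq⟩ := path f hvf hwf
  rw [(hB.subsingleton_path _ _).elim p q, hq] at hp
  simpa using hp.symm

end MultiHypergraph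

/-! ### Branching trees as incidence graphs of simple hypergraphs -/

namespace RootedBigraph

open MultiHypergraph

theorem IsBranching.isTree {b : Bool} {A : RootedBigraph} (hA : IsBranching b A) :
    A.graph.IsTree := by
  have hpt : ∀ b, (RootedBigraph.point b).graph.IsTree := by
    intro b
    have : Unique (RootedBigraph.point b).W := inferInstanceAs (Unique Unit)
    exact .of_subsingleton
  induction hA with
  | point => exact hpt _
  | leaf _ ih => exact (hpt _).sum_sup_edge ih _ _
  | join _ _ ih ih' => exact ih.sum_sup_edge ih' _ _

theorem IsBranching.side_root {b : Bool} {A : RootedBigraph} (hA : IsBranching b A) :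
    A.side A.root = b := by
  induction hA with
  | point => rfl
  | leaf _ _ => rfl
  | join _ _ ih _ => exact ih

theorem join_adj {A B : RootedBigraph} (a b : A.W ⊕ B.W) : (join A B).graph.Adj a b ↔
    (∃ x y, a = Sum.inl x ∧ b = Sum.inl y ∧ A.graph.Adj x y) ∨
    (∃ x y, a = Sum.inr x ∧ b = Sum.inr y ∧ B.graph.Adj x y) ∨
    (a = Sum.inl A.root ∧ b = Sum.inr B.root) ∨ (a = Sum.inr B.root ∧ b = Sum.inl A.root) := by
  change ((A.graph ⊕g B.graph) ⊔ SimpleGraph.edge _ _).Adj a b ↔ _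
  rcases a with a | a <;> rcases b with b | b <;> simp [SimpleGraph.edge_adj]

theorem side_ne_of_adj_join {A B : RootedBigraph} (hr : A.side A.root ≠ B.side B.root)
    (hA : ∀ x y, A.graph.Adj x y → A.side x ≠ A.side y)
    (hB : ∀ x y, B.graph.Adj x y → B.side x ≠ B.side y) (x y : (join A B).W)
    (h : (join A B).graph.Adj x y) : (join A B).side x ≠ (join A B).side y := by
  rcases (join_adj x y).1 h with ⟨x, y, rfl, rfl, hxy⟩ | ⟨x, y, rfl, rfl, hxy⟩ | ⟨rfl, rfl⟩ | ⟨rfl, rfl⟩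
  · exact hA _ _ hxy
  · exact hB _ _ hxy
  · exact hr
  · exact hr.symm

theorem IsBranching.side_ne_of_adj {b : Bool} {A : RootedBigraph} (hA : IsBranching b A) :
    ∀ x y, A.graph.Adj x y → A.side x ≠ A.side y := by
  induction hA with
  | point => exact fun _ _ h => h.elim
  | leaf hA ih =>
    exact side_ne_of_adj_join (by rw [hA.side_root]; exact Bool.false_ne_true)
      (fun _ _ h => h.elim) ih
  | join hA hB ih ih' =>
    refine side_ne_of_adj_join ?_ ih ih'
    rw [hA.side_root, hB.side_root]
    exact (Bool.not_ne_self _).symm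

theorem IsBranching.exists_adj_root {A : RootedBigraph} (hA : IsBranching false A) :
    ∃ x, A.graph.Adj A.root x := by
  cases hA with
  | leaf hA => exact ⟨Sum.inr _, (join_adj _ _).2 (Or.inr (Or.inr (Or.inl ⟨rfl, rfl⟩)))⟩
  | join hA hB => exact ⟨Sum.inr _, (join_adj _ _).2 (Or.inr (Or.inr (Or.inl ⟨rfl, rfl⟩)))⟩

theorem IsBranching.exists_adj_adj {b : Bool} {A : RootedBigraph} (hA : IsBranching b A) :
    ∀ x, A.side x = false → x ≠ A.root → ∃ y z, y ≠ z ∧ A.graph.Adj x y ∧ A.graph.Adj x z := by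
  have inr : ∀ (A B : RootedBigraph) (b : B.W), (∃ y z, y ≠ z ∧ B.graph.Adj b y ∧ B.graph.Adj b z) →
      ∃ y z, y ≠ z ∧ (A.join B).graph.Adj (Sum.inr b) y ∧ (A.join B).graph.Adj (Sum.inr b) z := by
    rintro A B b ⟨y, z, hyz, hy, hz⟩
    exact ⟨Sum.inr y, Sum.inr z, fun h => hyz (Sum.inr_injective h),
      (join_adj _ _).2 (Or.inr (Or.inl ⟨_, _, rfl, rfl, hy⟩)),
      (join_adj _ _).2 (Or.inr (Or.inl ⟨_, _, rfl, rfl, hz⟩))⟩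
  induction hA with
  | point => exact fun x _ hx => (hx rfl).elim
  | @leaf A hA ih =>
    rintro (x | x) hx hne
    · exact (hne rfl).elim
    · refine inr _ _ _ (ih x hx ?_)
      rintro rfl
      exact Bool.false_ne_true (hx.symm.trans hA.side_root)
  | @join b A B hA hB ih ih' =>
    rintro (x | x) hx hne
    · obtain ⟨y, z, hyz, hy, hz⟩ := ih x hx fun h => hne (congrArg Sum.inl h)
      exact ⟨Sum.inl y, Sum.inl z, fun h => hyz (Sum.inl_injective h),
        (join_adj _ _).2 (Or.inl ⟨_, _, rfl, rfl, hy⟩),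
        (join_adj _ _).2 (Or.inl ⟨_, _, rfl, rfl, hz⟩)⟩
    · by_cases hxr : x = B.root
      · subst hxr
        have hb : (!b) = false := hB.side_root.symm.trans hx
        -- An edge node that was the root of `B` has a child there and gains the root of `A` as a
        -- second neighbour.
        rw [hb] at hB
        obtain ⟨y, hy⟩ := hB.exists_adj_root
        exact ⟨Sum.inr y, Sum.inl A.root, Sum.inr_ne_inl,
          (join_adj _ _).2 (Or.inr (Or.inl ⟨_, _, rfl, rfl, hy⟩)),
          (join_adj _ _).2 (Or.inr (Or.inr (Or.inr ⟨rfl, rfl⟩)))⟩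
      · exact inr _ _ _ (ih' x hx hxr)

/-- A branching tree rooted at a vertex is the incidence graph of a connected Berge-acyclic
simple hypergraph. -/
theorem IsBranching.exists_hypergraph {A : RootedBigraph} (hA : IsBranching true A) :
    ∃ (VB EB : Type) (_ : Fintype VB) (_ : Fintype EB) (B : MultiHypergraph VB EB)
      (i : B.incidenceGraph ≃g A.graph),
      B.IsSimple ∧ B.IsConnected ∧ B.IsBergeAcyclic ∧ ∀ w, A.side (i w) = w.isLeft := by
  classical
  have hnbr : ∀ x, A.side x = false →
      ∃ y z, y ≠ z ∧ A.graph.Adj x y ∧ A.graph.Adj x z := fun x hx =>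
    hA.exists_adj_adj x hx fun h => Bool.false_ne_true (by rw [← hx, h, hA.side_root])
  have hside : ∀ {x y}, A.side x = false → A.graph.Adj x y → A.side y = true := by
    intro x y hx h
    have := hA.side_ne_of_adj x y h
    rw [hx] at this
    simpa using this.symm
  let B : MultiHypergraph {w // A.side w = true} {w // ¬ A.side w = true} :=
    { inc := fun e => Finset.univ.filter fun v => A.graph.Adj e.1 v.1
      inc_nonempty := fun e => by
        have he : A.side e.1 = false := by simpa using e.2
        obtain ⟨y, _, _, hy, _⟩ := hnbr e.1 he
        exact ⟨⟨y, hside he hy⟩, by simpa using hy⟩ }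
  have hB : ∀ v e, v ∈ B.inc e ↔ A.graph.Adj e.1 v.1 := by simp [B]
  let i : B.incidenceGraph ≃g A.graph :=
    { toEquiv := Equiv.sumCompl fun w => A.side w = true
      map_rel_iff' := by
        rintro (v | e) (w | f)
        · have h1 := not_incidenceGraph_adj_inl_inl B v w
          have h2 : ¬ A.graph.Adj v.1 w.1 := fun h =>
            hA.side_ne_of_adj _ _ h (v.2.trans w.2.symm)
          simp [h1, h2]
        · simp [incidenceGraph_adj_inl_inr, hB, SimpleGraph.adj_comm]
        · simp [incidenceGraph_adj_inr_inl, hB]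
        · have h1 := not_incidenceGraph_adj_inr_inr B e f
          have h2 : ¬ A.graph.Adj e.1 f.1 := fun h =>
            f.2 (hside (by simpa using e.2) h)
          simp [h1, h2] }
  have htree : B.incidenceGraph.IsTree := i.isTree_iff.2 hA.isTree
  refine ⟨_, _, inferInstance, inferInstance, B, i, ?_, htree.1, htree.2, ?_⟩
  · intro e f hef
    -- Parallel edges would share the two distinct neighbours of an edge node, which acyclicity
    -- excludes.
    have he : A.side e.1 = false := by simpa using e.2
    obtain ⟨y, z, hyz, hy, hz⟩ := hnbr e.1 he
    have hye : (⟨y, hside he hy⟩ : {w // A.side w = true}) ∈ B.inc e := (hB _ _).2 hy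
    have hze : (⟨z, hside he hz⟩ : {w // A.side w = true}) ∈ B.inc e := (hB _ _).2 hz
    exact IsBergeAcyclic.edge_unique htree.2 (fun h => hyz (congrArg Subtype.val h)) hye hze
      (hef ▸ hye) (hef ▸ hze)
  · rintro (v | e)
    · exact v.2
    · change A.side e.1 = false
      simpa using e.2

end RootedBigraph

/-! ### Disjoint unions, and from equal counts to equal colours -/

namespace MultiHypergraph

open RootedBigraph

variable {V : Type uV} {E : Type uE} {V' : Type uV'} {E' : Type uE'}

/-- The disjoint union of two hypergraphs. -/
def disjUnion (G : MultiHypergraph V E) (H : MultiHypergraph V' E') :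
    MultiHypergraph (V ⊕ V') (E ⊕ E') where
  inc := Sum.elim (fun e => (G.inc e).map Function.Embedding.inl)
    fun e => (H.inc e).map Function.Embedding.inr
  inc_nonempty := by
    rintro (e | e)
    · simpa using G.inc_nonempty e
    · simpa using H.inc_nonempty e

@[simp]
theorem inl_mem_disjUnion_inl (G : MultiHypergraph V E) (H : MultiHypergraph V' E') (v : V)
    (e : E) : Sum.inl v ∈ (G.disjUnion H).inc (Sum.inl e) ↔ v ∈ G.inc e := by
  change _ ∈ (G.inc e).map _ ↔ _
  rw [Finset.mem_map]
  simp

@[simp]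
theorem inr_mem_disjUnion_inr (G : MultiHypergraph V E) (H : MultiHypergraph V' E') (v : V')
    (e : E') : Sum.inr v ∈ (G.disjUnion H).inc (Sum.inr e) ↔ v ∈ H.inc e := by
  change _ ∈ (H.inc e).map _ ↔ _
  rw [Finset.mem_map]
  simp

@[simp]
theorem inl_notMem_disjUnion_inr (G : MultiHypergraph V E) (H : MultiHypergraph V' E') (v : V)
    (e : E') : Sum.inl v ∉ (G.disjUnion H).inc (Sum.inr e) := by
  change _ ∉ (H.inc e).map _
  rw [Finset.mem_map]
  simp

@[simp]
theorem inr_notMem_disjUnion_inl (G : MultiHypergraph V E) (H : MultiHypergraph V' E') (v : V')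
    (e : E) : Sum.inr v ∉ (G.disjUnion H).inc (Sum.inl e) := by
  change _ ∉ (G.inc e).map _
  rw [Finset.mem_map]
  simp

variable [Fintype V] [Fintype E] [Fintype V'] [Fintype E'] (G : MultiHypergraph V E)
  (H : MultiHypergraph V' E')

omit [Fintype V] in
theorem colour_succ [DecidableEq V] (i : ℕ) (v : V) : G.colour (i + 1) v =
    (Finset.univ.filter fun e => v ∈ G.inc e).val.map (G.edgeColour i) := by
  change Multiset.map (G.edgeColour i) _ = _
  congr!

omit [Fintype V] [Fintype V'] in
theorem colour_disjUnion_inl (i : ℕ) (v : V) :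
    (G.disjUnion H).colour i (Sum.inl v) = G.colour i v := by
  classical
  induction i generalizing v with
  | zero => rfl
  | succ i ih =>
    have : (Finset.univ.filter fun e => Sum.inl v ∈ (G.disjUnion H).inc e) =
        (Finset.univ.filter fun e => v ∈ G.inc e).map Function.Embedding.inl := by
      ext (e | e) <;> simp
    rw [colour_succ, colour_succ, this, Finset.map_val, Multiset.map_map]
    refine Multiset.map_congr rfl fun e _ => ?_
    change ((G.inc e).map _).val.map _ = (G.inc e).val.map _
    rw [Finset.map_val, Multiset.map_map]
    exact Multiset.map_congr rfl fun w _ => ih w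

omit [Fintype V] [Fintype V'] in
theorem colour_disjUnion_inr (i : ℕ) (v : V') :
    (G.disjUnion H).colour i (Sum.inr v) = H.colour i v := by
  classical
  induction i generalizing v with
  | zero => rfl
  | succ i ih =>
    have : (Finset.univ.filter fun e => Sum.inr v ∈ (G.disjUnion H).inc e) =
        (Finset.univ.filter fun e => v ∈ H.inc e).map Function.Embedding.inr := by
      ext (e | e) <;> simp
    rw [colour_succ, colour_succ, this, Finset.map_val, Multiset.map_map]
    refine Multiset.map_congr rfl fun e _ => ?_
    change ((H.inc e).map _).val.map _ = (H.inc e).val.map _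
    rw [Finset.map_val, Multiset.map_map]
    exact Multiset.map_congr rfl fun w _ => ih w

theorem neighborSum_disjUnion_inl (f : (V ⊕ V') ⊕ (E ⊕ E') → ℚ) (x : V ⊕ E) :
    (G.disjUnion H).incidenceGraph.neighborSum f (Sum.map Sum.inl Sum.inl x) =
      G.incidenceGraph.neighborSum (fun y => f (Sum.map Sum.inl Sum.inl y)) x := by
  classical
  rcases x with v | e
  · simp [neighborSum_inl]
  · simp [neighborSum_inr, -Finset.sum_ite_mem]

theorem neighborSum_disjUnion_inr (f : (V ⊕ V') ⊕ (E ⊕ E') → ℚ) (x : V' ⊕ E') :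
    (G.disjUnion H).incidenceGraph.neighborSum f (Sum.map Sum.inr Sum.inr x) =
      H.incidenceGraph.neighborSum (fun y => f (Sum.map Sum.inr Sum.inr y)) x := by
  classical
  rcases x with v | e
  · simp [neighborSum_inl]
  · simp [neighborSum_inr, -Finset.sum_ite_mem]

theorem count_disjUnion_inl {b : Bool} {A : RootedBigraph} (hA : IsBranching b A) (x : V ⊕ E) :
    A.count (G.disjUnion H) (Sum.map Sum.inl Sum.inl x) = A.count G x := by
  induction hA generalizing x with
  | point => simp [count_point]
  | leaf _ ih => simp [count_join, count_point, neighborSum_disjUnion_inl, ih]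
  | join _ _ ih ih' => simp [count_join, neighborSum_disjUnion_inl, ih, ih']

theorem count_disjUnion_inr {b : Bool} {A : RootedBigraph} (hA : IsBranching b A) (x : V' ⊕ E') :
    A.count (G.disjUnion H) (Sum.map Sum.inr Sum.inr x) = A.count H x := by
  induction hA generalizing x with
  | point => simp [count_point]
  | leaf _ ih => simp [count_join, count_point, neighborSum_disjUnion_inr, ih]
  | join _ _ ih ih' => simp [count_join, neighborSum_disjUnion_inr, ih, ih']

theorem inHom_eq_sum_count {A : RootedBigraph} (hA : IsBranching true A) {VB EB : Type*}
    [Fintype VB] [Fintype EB] {B : MultiHypergraph VB EB} (i : B.incidenceGraph ≃g A.graph)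
    (hi : ∀ w, A.side (i w) = w.isLeft) :
    (B.inHom G : ℚ) = ∑ v, A.count G (Sum.inl v) := by
  rw [inHom_eq_homSum]
  have := SimpleGraph.homSum_iso G.incidenceGraph i
    (fun w x => if A.side w = x.isLeft then 1 else 0)
  simp only [hi] at this
  rw [this, SimpleGraph.homSum_eq_sum_rootedHomSum _ _ _ A.root]
  change ∑ x, A.count G x = _
  rw [Fintype.sum_sum_type, add_eq_left]
  exact Finset.sum_eq_zero fun e _ => hA.count_eq_zero G (by simp)

variable {G H}

/-- Passing to the disjoint union ensures that one and the same linear combination of trees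
expresses the indicator of a colour on both hypergraphs. -/
theorem not_colourRefinementDistinguishes_of_inHom_eq
    (h : ∀ (VB EB : Type) [Fintype VB] [Fintype EB] (B : MultiHypergraph VB EB),
        B.IsSimple → B.IsConnected → B.IsBergeAcyclic → B.inHom G = B.inHom H) :
    ¬ G.ColourRefinementDistinguishes H := by
  classical
  rintro ⟨i, hne⟩
  refine hne (Multiset.ext.2 fun c => ?_)
  -- The equality is linear in `f`, and for the counting function of a tree its two sides are
  -- homomorphism numbers into `G` and `H`.
  have key : ∀ f ∈ countSpan (G.disjUnion H) true,
      ∑ v : V, f (Sum.inl (Sum.inl v)) = ∑ v : V', f (Sum.inl (Sum.inr v)) := by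
    intro f hf
    induction hf using Submodule.span_induction with
    | mem f hf =>
      obtain ⟨A, hA, rfl⟩ := hf
      obtain ⟨VB, EB, _, _, B, j, h1, h2, h3, hj⟩ := hA.exists_hypergraph
      have := congrArg (Nat.cast (R := ℚ)) (h VB EB B h1 h2 h3)
      rw [inHom_eq_sum_count G hA j hj, inHom_eq_sum_count H hA j hj] at this
      simp only [← count_disjUnion_inl G H hA, ← count_disjUnion_inr G H hA] at this
      exact this
    | zero => simp
    | add f g _ _ hf hg => simp [Finset.sum_add_distrib, hf, hg]
    | smul c f _ hf => simp [← Finset.mul_sum, hf]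
  have := key _ (colourIndicator_mem_countSpan i c)
  simp only [Sum.elim_inl, colour_disjUnion_inl, colour_disjUnion_inr] at this
  have h1 := Multiset.count_map_finset (Finset.univ : Finset V) (G.colour i) c
  have h2 := Multiset.count_map_finset (Finset.univ : Finset V') (H.colour i) c
  simp only [Finset.mem_univ, if_true] at h1 h2
  have h3 := h1.trans (Eq.trans (by congr!) (this.trans (Eq.trans (by congr!) h2.symm)))
  exact_mod_cast h3

/-! ### From equal colours to equal counts -/

/-- The previous colour is determined by the next one. -/
def Colour.pred : (i : ℕ) → Colour (i + 1) → Colour i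
  | 0 => fun _ => ()
  | i + 1 => fun (c : Multiset (Multiset (Colour (i + 1)))) =>
      (c.map (Multiset.map (Colour.pred i)) : Multiset (Multiset (Colour i)))

omit [Fintype V] in
theorem pred_colour (G : MultiHypergraph V E) (i : ℕ) (v : V) :
    Colour.pred i (G.colour (i + 1) v) = G.colour i v := by
  induction i generalizing v with
  | zero => rfl
  | succ i ih =>
    change Multiset.map (Multiset.map (Colour.pred i)) (Multiset.map (G.edgeColour (i + 1)) _) =
      Multiset.map (G.edgeColour i) _
    rw [Multiset.map_map]
    refine Multiset.map_congr rfl fun e _ => ?_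
    simp only [Function.comp_apply, edgeColour, Multiset.map_map, ih]

omit [Fintype V] in
theorem pred_edgeColour (G : MultiHypergraph V E) (i : ℕ) (e : E) :
    (G.edgeColour (i + 1) e).map (Colour.pred i) = G.edgeColour i e := by
  simp only [edgeColour, Multiset.map_map, Function.comp_def, pred_colour]

omit [Fintype V] in
theorem sum_edgeColour_eq (G : MultiHypergraph V E) (i : ℕ)
    (β : Multiset (Colour i) → ℚ) (v : V) :
    open Classical in
    (∑ e, if v ∈ G.inc e then β (G.edgeColour i e) else 0) =
      Multiset.sum (Multiset.map β (G.colour (i + 1) v : Multiset (Multiset (Colour i)))) := by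
  classical
  change _ = (Multiset.map β (Multiset.map (G.edgeColour i) _)).sum
  rw [Multiset.map_map, ← Finset.sum_filter]
  rfl

/-- The weights on the incidence graphs of two hypergraphs that are given by the same function of
the colours in the round `i`. -/
def SameColourWeights (G : MultiHypergraph V E) (H : MultiHypergraph V' E') (i : ℕ)
    (f : V ⊕ E → ℚ) (g : V' ⊕ E' → ℚ) : Prop :=
  ∃ (α : Colour i → ℚ) (β : Multiset (Colour i) → ℚ),
    f = Sum.elim (fun v => α (G.colour i v)) (fun e => β (G.edgeColour i e)) ∧
    g = Sum.elim (fun v => α (H.colour i v)) (fun e => β (H.edgeColour i e))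

-- Later colours determine earlier ones, so two weights from different rounds can be brought to a
-- common round before they are multiplied.
omit [Fintype V] [Fintype V'] in
theorem SameColourWeights.mono {i j : ℕ} (hij : i ≤ j) {f : V ⊕ E → ℚ} {g : V' ⊕ E' → ℚ}
    (h : SameColourWeights G H i f g) : SameColourWeights G H j f g := by
  induction hij with
  | refl => exact h
  | @step j _ ih =>
    obtain ⟨α, β, rfl, rfl⟩ := ih
    refine ⟨fun c => α (Colour.pred j c), fun c => β (c.map (Colour.pred j)), ?_, ?_⟩ <;>
      simp only [pred_colour, pred_edgeColour]

omit [Fintype V] [Fintype V'] in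
theorem SameColourWeights.mul {i : ℕ} {f f' : V ⊕ E → ℚ} {g g' : V' ⊕ E' → ℚ}
    (h : SameColourWeights G H i f g) (h' : SameColourWeights G H i f' g') :
    SameColourWeights G H i (fun x => f x * f' x) (fun x => g x * g' x) := by
  obtain ⟨α, β, rfl, rfl⟩ := h
  obtain ⟨α', β', rfl, rfl⟩ := h'
  refine ⟨fun c => α c * α' c, fun c => β c * β' c, ?_, ?_⟩ <;>
    exact funext fun x => by cases x <;> rfl

/-- The next colour of a vertex lists the colours of its edges. The colour of an edge in round `i`
already lists those of its vertices; it is rewritten in round `i + 1` so that both sides use the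
same round. -/
theorem neighborSum_colourWeights (G : MultiHypergraph V E) (i : ℕ) (α : Colour i → ℚ)
    (β : Multiset (Colour i) → ℚ) :
    G.incidenceGraph.neighborSum
      (Sum.elim (fun v => α (G.colour i v)) (fun e => β (G.edgeColour i e))) =
    Sum.elim (fun v => Multiset.sum (Multiset.map β
        (G.colour (i + 1) v : Multiset (Multiset (Colour i)))))
      (fun e => ((G.edgeColour (i + 1) e).map fun c => α (Colour.pred i c)).sum) := by
  classical
  funext x
  rcases x with v | e
  · simp only [neighborSum_inl, Sum.elim_inr, Sum.elim_inl, sum_edgeColour_eq]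
  · simp only [neighborSum_inr, Sum.elim_inr, Sum.elim_inl]
    rw [edgeColour, Multiset.map_map, Finset.sum_ite_mem, Finset.univ_inter]
    simp only [Function.comp_def, pred_colour]
    rfl

theorem SameColourWeights.neighborSum {i : ℕ} {f : V ⊕ E → ℚ} {g : V' ⊕ E' → ℚ}
    (h : SameColourWeights G H i f g) :
    SameColourWeights G H (i + 1) (G.incidenceGraph.neighborSum f)
      (H.incidenceGraph.neighborSum g) := by
  obtain ⟨α, β, rfl, rfl⟩ := h
  exact ⟨fun c : Multiset (Multiset (Colour i)) => (c.map β).sum,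
    fun m => (m.map fun c => α (Colour.pred i c)).sum, neighborSum_colourWeights G i α β, neighborSum_colourWeights H i α β⟩

theorem sum_vertexColour_eq (h : ¬ G.ColourRefinementDistinguishes H) (i : ℕ) (α : Colour i → ℚ) :
    ∑ v, α (G.colour i v) = ∑ v, α (H.colour i v) := by
  have h : (Finset.univ : Finset V).val.map (G.colour i) =
      (Finset.univ : Finset V').val.map (H.colour i) := by
    by_contra hne
    exact h ⟨i, hne⟩
  simpa [Multiset.map_map] using congrArg (fun s => (s.map α).sum) h

/-- Double counting: each edge splits its weight evenly among its vertices. Its size is positive and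
can be read off its colour, so the share is still a function of the colour. -/
theorem sum_edgeColour (G : MultiHypergraph V E) (i : ℕ) (β : Multiset (Colour i) → ℚ) :
    ∑ e, β (G.edgeColour i e) = ∑ v, Multiset.sum (Multiset.map (fun m => β m / Multiset.card m)
      (G.colour (i + 1) v : Multiset (Multiset (Colour i)))) := by
  classical
  simp only [← sum_edgeColour_eq]
  rw [Finset.sum_comm]
  refine Finset.sum_congr rfl fun e _ => ?_
  have hne : ((G.inc e).card : ℚ) ≠ 0 := by
    exact_mod_cast (Finset.card_pos.2 (G.inc_nonempty e)).ne'
  rw [Finset.sum_ite_mem, Finset.univ_inter, Finset.sum_const]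
  simp [edgeColour]
  field_simp

theorem SameColourWeights.sum_eq (h : ¬ G.ColourRefinementDistinguishes H) {i : ℕ}
    {f : V ⊕ E → ℚ} {g : V' ⊕ E' → ℚ} (hfg : SameColourWeights G H i f g) :
    ∑ x, f x = ∑ x, g x := by
  obtain ⟨α, β, rfl, rfl⟩ := hfg
  simp only [Fintype.sum_sum_type, Sum.elim_inl, Sum.elim_inr]
  rw [sum_vertexColour_eq h, sum_edgeColour, sum_edgeColour,
    sum_vertexColour_eq h (i + 1) fun c : Multiset (Multiset (Colour i)) =>
      Multiset.sum (Multiset.map (fun m => β m / Multiset.card m) c)]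

theorem inHom_eq_of_not_colourRefinementDistinguishes (h : ¬ G.ColourRefinementDistinguishes H)
    {VB EB : Type*} [Fintype VB] [Fintype EB] {B : MultiHypergraph VB EB}
    (hc : B.IsConnected) (ha : B.IsBergeAcyclic) : B.inHom G = B.inHom H := by
  have : (B.inHom G : ℚ) = B.inHom H := by
    rw [inHom_eq_homSum, inHom_eq_homSum]
    refine SimpleGraph.IsTree.homSum_eq _ _ (fun f g => ∃ i, SameColourWeights G H i f g)
      ?_ ?_ ?_ _ ⟨hc, ha⟩ _ _ ?_
    · rintro f f' g g' ⟨i, hi⟩ ⟨j, hj⟩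
      exact ⟨max i j, (hi.mono (le_max_left _ _)).mul (hj.mono (le_max_right _ _))⟩
    · rintro f f' ⟨i, hi⟩
      exact ⟨i + 1, hi.neighborSum⟩
    · rintro f f' ⟨i, hi⟩
      exact hi.sum_eq h
    · intro w
      -- The initial weight of a node is the indicator of its side, so constants on the vertices and
      -- on the edges suffice in round 0.
      refine ⟨0, fun _ => if w.isLeft = true then 1 else 0,
        fun _ => if w.isLeft = false then 1 else 0, ?_, ?_⟩ <;>
        exact funext fun x => by cases x <;> rfl
  exact_mod_cast this

end MultiHypergraph

theorem mainTheorem3 {V : Type uV} {E : Type uE} {V' : Type uV'} {E' : Type uE'}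
    [Fintype V] [Fintype E] [Fintype V'] [Fintype E']
    (G : MultiHypergraph V E) (H : MultiHypergraph V' E')
    (hG : G.IsSimple) (hH : H.IsSimple) :
    (∀ (VB EB : Type) [Fintype VB] [Fintype EB] (B : MultiHypergraph VB EB),
        B.IsSimple → B.IsConnected → B.IsBergeAcyclic → B.inHom G = B.inHom H) ↔
      ¬ G.ColourRefinementDistinguishes H :=
  ⟨MultiHypergraph.not_colourRefinementDistinguishes_of_inHom_eq, fun h _ _ _ _ _ _ hc ha =>
    MultiHypergraph.inHom_eq_of_not_colourRefinementDistinguishes h hc ha⟩
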